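/- Let $[n]=\{1,\dots,n\}$. The Hamming torus of dimension $d$ is the graph with vertex set $[n]^d$ in which two vertices are adjacent iff they differ in exactly one coordinate. Bootstrap percolation with threshold $\theta\in\mathbb N$ starts from a random set $\omega_0$ of open vertices, which contains every vertex independently with probability $p$; then $\omega_{j+1}$ consists of the vertices of $\omega_j$ together with all vertices that have at least $\theta$ neighbours in $\omega_j$, and $\omega_\infty=\bigcup_j\omega_j$. A plane is a set of $n^2$ vertices obtained by fixing all but two of the $d$ coordinates. The critical probability $p_c(2,d)$ (which also depends on $n$ and $\theta$) is the $p\in[0,1]$ for which $$\mathbb P_p(\text{there is a plane } F \text{ with } F\subseteq\omega_\infty)=\tfrac12 .$$ **Theorem 2.4.** Fix $d\ge 3$. There is $\theta_0=\theta_0(d)$ such that for every $\theta\ge\theta_0$ there is $n_0=n_0(d,\theta)$ such that for every $n\ge n_0$ there is exactly one such $p_c(2,d)$, and it satisfies $$n^{-1-\frac{2}{\theta}-\frac{4d^2+3}{\theta^{3/2}}}\;\le\; p_c(2,d)\;\le\; n^{-1-\frac{2}{\theta}-\frac{\sqrt{8(d-2.1)}}{\theta^{3/2}}}.$$ -/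

import Mathlib

namespace BootstrapPercolation

/-- The Hamming torus: the vertices are the points of `[n]^d`, and two vertices are adjacent iff
they differ in exactly one coordinate. -/
def hammingTorus (n d : ℕ) : SimpleGraph (Fin d → Fin n) where
  Adj v w := hammingDist v w = 1
  symm := ⟨fun v w h => by rwa [hammingDist_comm]⟩
  loopless := ⟨fun v h => by simp at h⟩

/-- One step of bootstrap percolation with threshold `θ` on the graph `G`: a vertex is open
afterwards iff it was open before or has at least `θ` open neighbours. A configuration is the
set of its open vertices. -/
def step {V : Type*} (G : SimpleGraph V) (θ : ℕ) (ω : Set V) : Set V :=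
  {v | v ∈ ω ∨ (θ : ℕ∞) ≤ (G.neighborSet v ∩ ω).encard}

/-- The configuration `ω_j` at time `j`, started from `ω_0 = ω`. -/
def configAt {V : Type*} (G : SimpleGraph V) (θ : ℕ) (ω : Set V) : ℕ → Set V
  | 0 => ω
  | j + 1 => step G θ (configAt G θ ω j)

/-- The final configuration `ω_∞`, the pointwise limit of the increasing sequence `ω_j`. -/
def finalConfig {V : Type*} (G : SimpleGraph V) (θ : ℕ) (ω : Set V) : Set V :=
  ⋃ j, configAt G θ ω j

/-- `S` is (the vertex set of) an `i`-dimensional subgraph of the Hamming torus: the coordinates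
in some set `I` of size `i` are free, and all the other coordinates are fixed. -/
def IsSubtorus (n d i : ℕ) (S : Set (Fin d → Fin n)) : Prop :=
  ∃ (I : Finset (Fin d)) (v : Fin d → Fin n), I.card = i ∧ S = {w | ∀ j, j ∉ I → w j = v j}

/-- The event that some `i`-dimensional subgraph of the Hamming torus is eventually open. -/
def eventuallyOpen (n d θ i : ℕ) : Set (Set (Fin d → Fin n)) :=
  {ω | ∃ S, IsSubtorus n d i S ∧ S ⊆ finalConfig (hammingTorus n d) θ ω}

/-- The probability that some `i`-dimensional subgraph is eventually open, when every vertex is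
initially open with probability `p`, independently of the others. -/
noncomputable def openProb (n d θ i : ℕ) (p : unitInterval) : ℝ :=
  (ProbabilityTheory.setBernoulli (Set.univ : Set (Fin d → Fin n)) p).real
    (eventuallyOpen n d θ i)

/-- `p` is the critical probability `p_c(i, d)`, for side length `n` and threshold `θ`. -/
def IsCriticalProb (n d θ i : ℕ) (p : unitInterval) : Prop :=
  openProb n d θ i p = 1 / 2

end BootstrapPercolation

/-!
Write `p = n ^ (-1 - a)`.

If `p` is large, some plane contains `h ≈ θ / 2` rows and `h` columns, the `i`-th of each (counted
from `0`) with `h - i` open points off the chosen lines. These lines then fill up one after another,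
because the filled ones help the later ones, and together they fill the plane. A row with `k` open
points in prescribed blocks of linear size has probability of order `n ^ (-k a)`, and there are
linearly many rows to choose from, so the `i`-th row costs a factor `n ^ (1 - (h - i) a)`, and this
only if `(h - i) a > 1`. For `a = 2 / θ + c / θ ^ (3 / 2)` the total cost `n ^ (-2 S)` for one plane
has `2 S` close to `c ^ 2 / 8`, while there are `n ^ (d - 2)` disjoint planes.

If `p` is small, call a vertex rich if it has `T` open neighbours, and a line heavy if it contains
`k` rich vertices. By a first moment bound no plane contains `k` rich vertices in pairwise
distinct rows and columns, since each of them would have about `T` open neighbours not shared with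
the others. By maximality of a matching, the rich vertices of every plane are then covered by
fewer than `k` rows and `k` columns. Therefore a vertex that is neither open nor rich nor on a
heavy line has fewer than `T` open neighbours, and along each axis at most `d k` further
neighbours that are rich or on a heavy line. For `T + d ^ 2 k ≤ θ` it follows that the open
vertices, the rich vertices and the heavy lines form a set that is closed under the dynamics, and
this set contains no plane.
-/

open Filter Finset MeasureTheory ProbabilityTheory Topology

namespace BootstrapPercolation

section Bernoulli
variable {V ι : Type*} {p q : unitInterval} {B B' : Set V} {E E' : Set (Set V)}

theorem map_mem_setBernoulli_univ (p : unitInterval) (v : V) :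
    setBer(Set.univ, p).map (fun ω => v ∈ ω) =
      unitInterval.toNNReal p • Measure.dirac True +
        unitInterval.toNNReal (unitInterval.symm p) • Measure.dirac False := by
  rw [setBernoulli_eq_map, Measure.map_map (measurable_set_mem v) measurable_setOfPred]
  simp only [Set.mem_univ]
  exact Measure.infinitePi_map_eval _ v

theorem iIndepFun_mem_setBernoulli_univ (p : unitInterval) :
    iIndepFun (fun (v : V) (ω : Set V) => v ∈ ω) setBer(Set.univ, p) := by
  rw [iIndepFun_iff_map_fun_eq_infinitePi_map fun v => measurable_set_mem v]
  simp_rw [map_mem_setBernoulli_univ]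
  rw [setBernoulli_eq_map, Measure.map_map (by fun_prop) measurable_setOfPred]
  simp [Function.comp_def]

theorem setBernoulli_real_mem (p : unitInterval) (v : V) :
    setBer(Set.univ, p).real {ω | v ∈ ω} = p := by
  have h : setBer(Set.univ, p) {ω | v ∈ ω} =
      setBer(Set.univ, p).map (fun ω => v ∈ ω) {True} := by
    rw [Measure.map_apply (measurable_set_mem v) .of_discrete]
    simp [Set.preimage]
  rw [measureReal_def, h, map_mem_setBernoulli_univ]
  simp

/-- This couples the configurations of all densities on one probability space. -/
theorem map_uniform_labels (p : unitInterval) :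
    (Measure.infinitePi fun _ : V => (volume : Measure unitInterval)).map
      (fun U => {v | U v ≤ p}) = setBer(Set.univ, p) := by
  have measurable_le : Measurable fun x => x ≤ p := measurableSet_setOfPred.1 measurableSet_Iic
  have marginal : (volume : Measure unitInterval).map (fun x => x ≤ p) =
      unitInterval.toNNReal p • Measure.dirac True +
        unitInterval.toNNReal (unitInterval.symm p) • Measure.dirac False := by
    have coe_toNNReal (x : unitInterval) : ENNReal.ofReal x = unitInterval.toNNReal x :=
      ENNReal.ofReal_eq_coe_nnreal x.2.1
    refine Measure.ext_of_singleton fun P => ?_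
    rw [Measure.map_apply measurable_le .of_discrete]
    by_cases hP : P
    · have : (fun x => x ≤ p) ⁻¹' {P} = Set.Iic p := by ext; simp [hP]
      rw [this, unitInterval.volume_Iic]
      simp [hP, coe_toNNReal]
    · have : (fun x => x ≤ p) ⁻¹' {P} = Set.Ioi p := by ext; simp [hP]
      rw [this, unitInterval.volume_Ioi]
      simp [hP, ← unitInterval.coe_symm_eq, coe_toNNReal]
  rw [setBernoulli_eq_map]
  simp only [Set.mem_univ, ← marginal]
  rw [← Measure.infinitePi_map_pi _ fun _ => measurable_le,
    Measure.map_map measurable_setOfPred (by fun_prop)]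
  rfl

theorem setBernoulli_real_eq_labels (hE : MeasurableSet E) :
    setBer(Set.univ, p).real E =
      (Measure.infinitePi fun _ : V => (volume : Measure unitInterval)).real
        {U | {v | U v ≤ p} ∈ E} := by
  have : Measurable fun U : V → unitInterval => {v | U v ≤ p} :=
    measurable_set_iff.2 fun v => measurableSet_setOfPred.1 <|
      measurableSet_le (measurable_pi_apply v) measurable_const
  rw [← map_uniform_labels, map_measureReal_apply this hE]
  rfl

theorem setBernoulli_real_strictMono [Finite V] (hE : IsUpperSet E) (h0 : ∅ ∉ E)
    (h1 : Set.univ ∈ E) : StrictMono fun p => setBer(Set.univ, p).real E := by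
  intro p q hpq
  have := Fintype.ofFinite V
  let μ := Measure.infinitePi fun _ : V => (volume : Measure unitInterval)
  let sandwiched := Set.univ.pi fun _ : V => Set.Ioc p q
  have sandwiched_pos : 0 < μ.real sandwiched := by
    rw [measureReal_def, Measure.infinitePi_pi_univ _ fun _ => measurableSet_Ioc]
    simp only [unitInterval.volume_Ioc, tprod_fintype, prod_const, ENNReal.toReal_pow]
    exact pow_pos (ENNReal.toReal_pos (by simpa using hpq) ENNReal.ofReal_ne_top) _
  have subset : {U | {v | U v ≤ p} ∈ E} ∪ sandwiched ⊆ {U | {v | U v ≤ q} ∈ E} := by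
    rintro U (hU | hU)
    · exact hE (fun v hv => le_trans hv hpq.le) hU
    · have : {v | U v ≤ q} = Set.univ := Set.eq_univ_of_forall fun v => (hU v trivial).2
      rwa [Set.mem_ofPred_eq, this]
  have disjoint : Disjoint {U | {v | U v ≤ p} ∈ E} sandwiched := by
    refine Set.disjoint_left.2 fun U hU hU' => h0 ?_
    have : {v | U v ≤ p} = ∅ :=
      Set.eq_empty_of_forall_notMem fun v => (hU' v trivial).1.not_ge
    exact this ▸ hU
  calc setBer(Set.univ, p).real E
      = μ.real {U | {v | U v ≤ p} ∈ E} := setBernoulli_real_eq_labels .of_discrete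
    _ < μ.real {U | {v | U v ≤ p} ∈ E} + μ.real sandwiched := lt_add_of_pos_right _ sandwiched_pos
    _ = μ.real ({U | {v | U v ≤ p} ∈ E} ∪ sandwiched) :=
      (measureReal_union disjoint (.univ_pi fun _ => measurableSet_Ioc)).symm
    _ ≤ μ.real {U | {v | U v ≤ q} ∈ E} := measureReal_mono subset
    _ = setBer(Set.univ, q).real E := (setBernoulli_real_eq_labels .of_discrete).symm

/-- The `σ`-algebra of the events that depend only on the states of the vertices in `B`. -/
abbrev stateAlgebra (B : Set V) : MeasurableSpace (Set V) :=
  ⨆ v ∈ B, MeasurableSpace.comap (fun ω : Set V => v ∈ ω) ⊤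

theorem stateAlgebra_le (B : Set V) : stateAlgebra B ≤ Set.instMeasurableSpace :=
  iSup₂_le fun v _ => (measurable_set_mem v).comap_le

theorem stateAlgebra_mono (h : B ⊆ B') : stateAlgebra B ≤ stateAlgebra B' :=
  biSup_mono h

theorem measurableSet_stateAlgebra_mem {v : V} (hv : v ∈ B) :
    MeasurableSet[stateAlgebra B] {ω : Set V | v ∈ ω} :=
  le_iSup₂ (f := fun v (_ : v ∈ B) => MeasurableSpace.comap (fun ω : Set V => v ∈ ω) ⊤) v hv _
    ⟨{True}, trivial, by ext; simp⟩

theorem setBernoulli_real_inter (hB : Disjoint B B') (hE : MeasurableSet[stateAlgebra B] E)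
    (hE' : MeasurableSet[stateAlgebra B'] E') :
    setBer(Set.univ, p).real (E ∩ E') =
      setBer(Set.univ, p).real E * setBer(Set.univ, p).real E' := by
  have h : Indep (stateAlgebra B) (stateAlgebra B') setBer(Set.univ, p) :=
    indep_iSup_of_disjoint (fun v => (measurable_set_mem v).comap_le)
      (iIndepFun_mem_setBernoulli_univ p) hB
  simp only [measureReal_def, Indep_iff .. |>.1 h E E' hE hE', ENNReal.toReal_mul]

variable {t : Finset ι} {F : ι → Set (Set V)} {C : ι → Set V}

theorem setBernoulli_real_biInter (hF : ∀ i ∈ t, MeasurableSet[stateAlgebra (C i)] (F i))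
    (hC : (t : Set ι).PairwiseDisjoint C) :
    setBer(Set.univ, p).real (⋂ i ∈ t, F i) = ∏ i ∈ t, setBer(Set.univ, p).real (F i) := by
  classical
  induction t using Finset.induction_on with
  | empty => simp
  | insert a t ha ih =>
    rw [coe_insert, Set.pairwiseDisjoint_insert_of_notMem (by simpa using ha)] at hC
    rw [Finset.forall_mem_insert] at hF
    rw [set_biInter_insert, prod_insert ha, ← ih hF.2 hC.1]
    refine setBernoulli_real_inter (B' := ⋃ i ∈ t, C i) ?_ hF.1 ?_
    · exact Set.disjoint_iUnion₂_right.2 hC.2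
    · exact t.measurableSet_biInter fun i hi =>
        stateAlgebra_mono (Set.subset_biUnion_of_mem (u := C) hi) _ (hF.2 i hi)

theorem setBernoulli_real_biUnion (hF : ∀ i ∈ t, MeasurableSet[stateAlgebra (C i)] (F i))
    (hC : (t : Set ι).PairwiseDisjoint C) :
    setBer(Set.univ, p).real (⋃ i ∈ t, F i) =
      1 - ∏ i ∈ t, (1 - setBer(Set.univ, p).real (F i)) := by
  have hF' : ∀ i ∈ t, MeasurableSet (F i) := fun i hi => stateAlgebra_le _ _ (hF i hi)
  have h := setBernoulli_real_biInter (p := p) (fun i hi => (hF i hi).compl) hC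
  rw [← Set.compl_iUnion₂, probReal_compl_eq_one_sub (t.measurableSet_biUnion hF'),
    prod_congr rfl fun i hi => probReal_compl_eq_one_sub (hF' i hi)] at h
  linarith

theorem setBernoulli_real_superset (p : unitInterval) (S : Finset V) :
    setBer(Set.univ, p).real {ω | (S : Set V) ⊆ ω} = (p : ℝ) ^ #S := by
  have h : {ω | (S : Set V) ⊆ ω} = ⋂ v ∈ S, {ω | v ∈ ω} := by ext; simp [Set.subset_def]
  rw [h, setBernoulli_real_biInter (C := fun v => {v})
    (fun v _ => measurableSet_stateAlgebra_mem rfl) fun v _ w _ => Set.disjoint_singleton.2]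
  simp only [setBernoulli_real_mem, prod_const]

theorem continuous_setBernoulli_real [Finite V] (E : Set (Set V)) :
    Continuous fun p => setBer(Set.univ, p).real E := by
  have h : ∀ p, setBer(Set.univ, p).real E =
      ∑ s ∈ E.toFinite.toFinset, (p : ℝ) ^ s.ncard * (1 - p : ℝ) ^ (sᶜ).ncard := fun p => by
    rw [← E.toFinite.coe_toFinset, ← sum_measureReal_singleton]
    simp [setBernoulli_real_singleton p (Set.subset_univ _) Set.finite_univ,
      Set.compl_eq_univ_sdiff]
  simp only [h]
  fun_prop

end Bernoulli

section Dynamics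
variable {V : Type*} {G : SimpleGraph V} {θ : ℕ} {ω ω' C : Set V}

theorem subset_step (G : SimpleGraph V) (θ : ℕ) (ω : Set V) : ω ⊆ step G θ ω :=
  fun _ => Or.inl

theorem step_mono (h : ω ⊆ ω') : step G θ ω ⊆ step G θ ω' :=
  fun _ hv => hv.imp (@h _) fun hv =>
    hv.trans <| Set.encard_le_encard <| Set.inter_subset_inter_right _ h

theorem configAt_monotone (G : SimpleGraph V) (θ : ℕ) (ω : Set V) : Monotone (configAt G θ ω) :=
  monotone_nat_of_le_succ fun _ => subset_step _ _ _

theorem configAt_mono (h : ω ⊆ ω') : ∀ j, configAt G θ ω j ⊆ configAt G θ ω' j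
  | 0 => h
  | j + 1 => step_mono (configAt_mono h j)

theorem finalConfig_mono (h : ω ⊆ ω') : finalConfig G θ ω ⊆ finalConfig G θ ω' :=
  Set.iUnion_mono (configAt_mono h)

theorem subset_finalConfig (G : SimpleGraph V) (θ : ℕ) (ω : Set V) : ω ⊆ finalConfig G θ ω :=
  Set.subset_iUnion (configAt G θ ω) 0

theorem finalConfig_subset (h : ω ⊆ C) (hC : step G θ C ⊆ C) : finalConfig G θ ω ⊆ C := by
  refine Set.iUnion_subset fun j => ?_
  induction j with
  | zero => exact h
  | succ j ih => exact (step_mono ih).trans hC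

theorem step_finalConfig_subset : step G θ (finalConfig G θ ω) ⊆ finalConfig G θ ω := by
  rintro v (hv | hv)
  · exact hv
  obtain ⟨A, hA, hcard⟩ := Set.exists_subset_encard_eq hv
  lift A to Finset V using Set.finite_of_encard_eq_coe hcard
  obtain ⟨j, hj⟩ : ∃ j, (A : Set V) ⊆ configAt G θ ω j :=
    (configAt_monotone G θ ω).directed_le.exists_mem_subset_of_finset_subset_biUnion
      fun a ha => (hA ha).2
  refine Set.mem_iUnion.2 ⟨j + 1, Or.inr ?_⟩
  exact hcard ▸ Set.encard_le_encard fun a ha => ⟨(hA ha).1, hj ha⟩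

end Dynamics

section Torus
variable {n d θ i : ℕ}

theorem hammingTorus_adj_iff {v w : Fin d → Fin n} :
    (hammingTorus n d).Adj v w ↔ ∃ j x, x ≠ v j ∧ w = Function.update v j x := by
  change hammingDist v w = 1 ↔ _
  simp only [hammingDist, Finset.card_eq_one, Finset.ext_iff, mem_filter_univ, mem_singleton]
  constructor
  · rintro ⟨j, hj⟩
    exact ⟨j, w j, ((hj j).2 rfl).symm, Function.eq_update_iff.2
      ⟨rfl, fun l hl => (not_not.1 (mt (hj l).1 hl)).symm⟩⟩
  · rintro ⟨j, x, hx, rfl⟩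
    refine ⟨j, fun l => ?_⟩
    by_cases hl : l = j
    · subst hl; simpa using hx.symm
    · simp [hl]

theorem isUpperSet_eventuallyOpen : IsUpperSet (eventuallyOpen n d θ i) :=
  fun _ _ hω ⟨S, hS, hSω⟩ => ⟨S, hS, hSω.trans (finalConfig_mono hω)⟩

theorem empty_notMem_eventuallyOpen (hθ : 0 < θ) : ∅ ∉ eventuallyOpen n d θ i := by
  rintro ⟨_, ⟨I, v, -, rfl⟩, hS⟩
  have closed : step (hammingTorus n d) θ ∅ ⊆ ∅ := by
    rintro w (hw | hw)
    · exact hw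
    · simp [hθ.ne'] at hw
  exact finalConfig_subset subset_rfl closed (hS fun _ _ => rfl : v ∈ _)

theorem univ_mem_eventuallyOpen (hn : 0 < n) (hi : i ≤ d) :
    Set.univ ∈ eventuallyOpen n d θ i := by
  obtain ⟨I, -, hI⟩ := exists_subset_card_eq (s := (univ : Finset (Fin d))) (by simpa using hi)
  exact ⟨_, ⟨I, fun _ => ⟨0, hn⟩, hI, rfl⟩, fun _ _ => subset_finalConfig _ _ _ trivial⟩

theorem existsUnique_isCriticalProb (hn : 0 < n) (hθ : 0 < θ) (hi : i ≤ d) :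
    ∃! p : unitInterval, IsCriticalProb n d θ i p := by
  have empty_notMem := empty_notMem_eventuallyOpen (n := n) (d := d) (i := i) hθ
  have univ_mem := univ_mem_eventuallyOpen (θ := θ) hn hi
  have strictMono : StrictMono (openProb n d θ i) :=
    setBernoulli_real_strictMono isUpperSet_eventuallyOpen empty_notMem univ_mem
  have continuous : Continuous (openProb n d θ i) := continuous_setBernoulli_real _
  have zero : openProb n d θ i 0 = 0 := by simp [openProb, measureReal_def, empty_notMem]
  have one : openProb n d θ i 1 = 1 := by simp [openProb, measureReal_def, univ_mem]
  obtain ⟨p, -, hp⟩ := intermediate_value_Icc (zero_le_one (α := unitInterval))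
    continuous.continuousOn (show (1 / 2 : ℝ) ∈ _ by rw [zero, one]; norm_num)
  exact ⟨p, hp, fun q hq => strictMono.injective (hq.trans hp.symm)⟩

end Torus

section Grid
variable {α : Type*} {θ h : ℕ} {L : Set α} {P : α → α → Prop}

/-- `P` is closed under bootstrap percolation with threshold `θ` on the grid `α × α`, where
`(x, y)` is adjacent to the points `(a, y)` and `(x, b)` with `a ≠ x` and `b ≠ y`. -/
def GridClosed (θ : ℕ) (P : α → α → Prop) : Prop :=
  ∀ ⦃x y⦄ ⦃A B : Finset α⦄, x ∉ A → y ∉ B → (∀ a ∈ A, P a y) → (∀ b ∈ B, P x b) →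
    θ ≤ #A + #B → P x y

theorem GridClosed.swap (hP : GridClosed θ P) : GridClosed θ fun x y => P y x :=
  fun _ _ _ _ hA hB hAP hBP hθ => hP hB hA hBP hAP (by omega)

/-- Half of a nucleus: distinct lines `ρ i`, `i < h`, each with a set `R i` of `h - i` points
satisfying `P`. The lines have their indices in `L` and the points in its complement, so that the
points of a half nucleus are not on the lines of a transposed one. -/
structure IsHalfNucleus (L : Set α) (h : ℕ) (P : α → α → Prop) (ρ : ℕ → α) (R : ℕ → Finset α) :
    Prop where
  injOn : Set.InjOn ρ (Set.Iio h)
  line_mem : ∀ i < h, ρ i ∈ L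
  point_notMem : ∀ i < h, ∀ x ∈ R i, x ∉ L
  le_card : ∀ i < h, h - i ≤ #(R i)
  prop : ∀ i < h, ∀ x ∈ R i, P x (ρ i)

variable {ρ γ : ℕ → α} {R Q : ℕ → Finset α} {i j : ℕ}

namespace IsHalfNucleus

theorem mono {P' : α → α → Prop} (hρ : IsHalfNucleus L h P ρ R) (hP : ∀ x y, P x y → P' x y) :
    IsHalfNucleus L h P' ρ R :=
  { hρ with prop := fun i hi x hx => hP _ _ (hρ.prop i hi x hx) }

theorem line_notMem_points {P' : α → α → Prop} (hρ : IsHalfNucleus L h P ρ R)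
    (hγ : IsHalfNucleus L h P' γ Q) (hi : i < h) (hj : j < h) : γ j ∉ R i :=
  fun hmem => hρ.point_notMem i hi _ hmem (hγ.line_mem j hj)

variable [DecidableEq α]

theorem notMem_lines (hρ : IsHalfNucleus L h P ρ R) (hi : i < h) : ρ i ∉ (range i).image ρ := by
  intro hmem
  obtain ⟨l, hl, e⟩ := mem_image.1 hmem
  rw [mem_range] at hl
  exact hl.ne (hρ.injOn (hl.trans hi) hi e)

theorem card_lines (hρ : IsHalfNucleus L h P ρ R) (hi : i ≤ h) : #((range i).image ρ) = i := by
  rw [card_image_of_injOn, card_range]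
  exact hρ.injOn.mono fun l hl => (mem_range.1 hl).trans_le hi

theorem card_points_union_lines {P' : α → α → Prop} (hρ : IsHalfNucleus L h P ρ R)
    (hγ : IsHalfNucleus L h P' γ Q) (hi : i < h) (hj : j ≤ h) :
    h - i + j ≤ #(R i ∪ (range j).image γ) := by
  rw [card_union_of_disjoint, hγ.card_lines hj]
  · exact Nat.add_le_add_right (hρ.le_card i hi) j
  · refine disjoint_left.2 fun x hx hxγ => hρ.point_notMem i hi x hx ?_
    obtain ⟨l, hl, rfl⟩ := mem_image.1 hxγ
    exact hγ.line_mem l ((mem_range.1 hl).trans_le hj)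

end IsHalfNucleus

variable (hP : GridClosed θ P) (hθ : θ ≤ 2 * h) (hρ : IsHalfNucleus L h P ρ R)
  (hγ : IsHalfNucleus L h (fun x y => P y x) γ Q)
include hP hθ hρ hγ

theorem GridClosed.crossing : ∀ i < h, ∀ j < h, P (γ j) (ρ i) := by
  classical
  intro i
  induction i using Nat.strong_induction_on with
  | _ i ih_row =>
    intro hi j
    induction j using Nat.strong_induction_on with
    | _ j ih_col =>
      intro hj
      refine hP (A := R i ∪ (range j).image γ) (B := Q j ∪ (range i).image ρ) ?_ ?_ ?_ ?_ ?_
      · simp only [notMem_union]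
        exact ⟨hρ.line_notMem_points hγ hi hj, hγ.notMem_lines hj⟩
      · simp only [notMem_union]
        exact ⟨hγ.line_notMem_points hρ hj hi, hρ.notMem_lines hi⟩
      · simp only [forall_mem_union, forall_mem_image, mem_range]
        exact ⟨hρ.prop i hi, fun l hl => ih_col l hl (hl.trans hj)⟩
      · simp only [forall_mem_union, forall_mem_image, mem_range]
        exact ⟨hγ.prop j hj, fun l hl => ih_row l hl (hl.trans hi) j hj⟩
      · have := hρ.card_points_union_lines hγ hi hj.le
        have := hγ.card_points_union_lines hρ hj hi.le
        omega

theorem GridClosed.lines (y : α) : ∀ j < h, P (γ j) y := by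
  classical
  intro j
  induction j using Nat.strong_induction_on with
  | _ j ih =>
    intro hj
    have known : ∀ b ∈ Q j ∪ (range h).image ρ, P (γ j) b := by
      simp only [forall_mem_union, forall_mem_image, mem_range]
      exact ⟨hγ.prop j hj, fun i hi => hP.crossing hθ hρ hγ i hi j hj⟩
    by_cases hy : y ∈ Q j ∪ (range h).image ρ
    · exact known y hy
    refine hP (A := (range j).image γ) (hγ.notMem_lines hj) hy ?_ known ?_
    · simp only [forall_mem_image, mem_range]
      exact fun l hl => ih l hl (hl.trans hj)
    · have := hγ.card_lines hj.le
      have := hγ.card_points_union_lines hρ hj le_rfl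
      omega

theorem GridClosed.fill (x y : α) : P x y := by
  classical
  have columns : ∀ a ∈ (range h).image γ, P a y := by
    simp only [forall_mem_image, mem_range]
    exact hP.lines hθ hρ hγ y
  have rows : ∀ b ∈ (range h).image ρ, P x b := by
    simp only [forall_mem_image, mem_range]
    exact hP.swap.lines hθ hγ hρ x
  by_cases hx : x ∈ (range h).image γ
  · exact columns x hx
  by_cases hy : y ∈ (range h).image ρ
  · exact rows y hy
  refine hP hx hy columns rows ?_
  rw [hγ.card_lines le_rfl, hρ.card_lines le_rfl]
  omega

end Grid

section Cell
variable {n d θ : ℕ} {c₀ c₁ : Fin d} {w : Fin d → Fin n} {x x' y y' : Fin n}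

/-- The point with coordinates `x`, `y` of the plane through `w` in the directions `c₀`, `c₁`. -/
def cell (c₀ c₁ : Fin d) (w : Fin d → Fin n) (x y : Fin n) : Fin d → Fin n :=
  Function.update (Function.update w c₀ x) c₁ y

theorem cell_fst (hc : c₀ ≠ c₁) : cell c₀ c₁ w x y c₀ = x := by simp [cell, hc]

theorem cell_snd : cell c₀ c₁ w x y c₁ = y := by simp [cell]

theorem cell_of_ne {j : Fin d} (h₀ : j ≠ c₀) (h₁ : j ≠ c₁) : cell c₀ c₁ w x y j = w j := by
  simp [cell, h₀, h₁]

theorem injective2_cell (hc : c₀ ≠ c₁) : Function.Injective2 (cell c₀ c₁ w) := by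
  intro x x' y y' e
  have e₀ := congrFun e c₀
  have e₁ := congrFun e c₁
  rw [cell_fst hc, cell_fst hc] at e₀
  rw [cell_snd, cell_snd] at e₁
  exact ⟨e₀, e₁⟩

theorem cell_adj_fst (hc : c₀ ≠ c₁) (h : x' ≠ x) :
    (hammingTorus n d).Adj (cell c₀ c₁ w x y) (cell c₀ c₁ w x' y) := by
  refine hammingTorus_adj_iff.2 ⟨c₀, x', by rwa [cell_fst hc], ?_⟩
  rw [cell, cell, Function.update_comm hc.symm, Function.update_idem, Function.update_comm hc]

theorem cell_adj_snd (h : y' ≠ y) :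
    (hammingTorus n d).Adj (cell c₀ c₁ w x y) (cell c₀ c₁ w x y') := by
  refine hammingTorus_adj_iff.2 ⟨c₁, y', by rwa [cell_snd], ?_⟩
  rw [cell, cell, Function.update_idem]

theorem gridClosed_finalConfig (hc : c₀ ≠ c₁) (w : Fin d → Fin n) (ω : Set (Fin d → Fin n)) :
    GridClosed θ fun x y => cell c₀ c₁ w x y ∈ finalConfig (hammingTorus n d) θ ω := by
  intro x y A B hx hy hA hB hcard
  let row := A.map ⟨fun a => cell c₀ c₁ w a y, (injective2_cell hc).left y⟩
  let column := B.map ⟨cell c₀ c₁ w x, (injective2_cell hc).right x⟩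
  have disjoint : Disjoint row column := by
    simp only [row, column, disjoint_left, Finset.mem_map, not_exists, not_and,
      Function.Embedding.coeFn_mk]
    rintro _ ⟨a, ha, rfl⟩ b _ e
    obtain ⟨rfl, -⟩ := injective2_cell hc e
    exact hx ha
  have subset : (row ∪ column : Set (Fin d → Fin n)) ⊆
      (hammingTorus n d).neighborSet (cell c₀ c₁ w x y) ∩ finalConfig (hammingTorus n d) θ ω := by
    simp only [row, column, coe_map, Set.union_subset_iff, Set.image_subset_iff]
    exact ⟨fun a ha => ⟨cell_adj_fst hc (ne_of_mem_of_not_mem ha hx), hA a ha⟩,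
      fun b hb => ⟨cell_adj_snd (ne_of_mem_of_not_mem hb hy), hB b hb⟩⟩
  refine step_finalConfig_subset (Or.inr (le_trans ?_ (Set.encard_le_encard subset)))
  rw [← coe_union, Set.encard_coe_eq_coe_finsetCard, card_union_of_disjoint disjoint, card_map,
    card_map]
  exact_mod_cast hcard

theorem isSubtorus_image2_cell (hc : c₀ ≠ c₁) (w : Fin d → Fin n) :
    IsSubtorus n d 2 (Set.image2 (cell c₀ c₁ w) Set.univ Set.univ) := by
  refine ⟨{c₀, c₁}, w, card_pair hc, Set.ext fun v => ⟨?_, fun h => ?_⟩⟩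
  · rintro ⟨x, -, y, -, rfl⟩ j hj
    simp only [mem_insert, mem_singleton, not_or] at hj
    exact cell_of_ne hj.1 hj.2
  · refine ⟨v c₀, trivial, v c₁, trivial, funext fun j => ?_⟩
    by_cases h₁ : j = c₁
    · subst h₁; rw [cell_snd]
    by_cases h₀ : j = c₀
    · subst h₀; rw [cell_fst hc]
    rw [cell_of_ne h₀ h₁]
    exact (h j (by simp [h₀, h₁])).symm

end Cell

section Nucleation
variable {V : Type*} {n b h k m : ℕ} {p : unitInterval} {g : Fin n → Fin n → V} {y : Fin n}

/-- The `m`-th block of `b` consecutive elements of `Fin n`. -/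
def block (n b m : ℕ) : Finset (Fin n) := {x | x.val / b = m}

theorem card_block (hb : 0 < b) (hm : (m + 1) * b ≤ n) : #(block n b m) = b := by
  have e : (block n b m).map Fin.valEmbedding = Ico (m * b) ((m + 1) * b) := by
    ext x
    simp only [block, Finset.mem_map, mem_filter_univ, Fin.valEmbedding_apply, mem_Ico,
      Nat.div_eq_iff hb, add_mul] at hm ⊢
    exact ⟨by rintro ⟨y, hy, rfl⟩; omega, fun hx => ⟨⟨x, by omega⟩, by dsimp only; omega, rfl⟩⟩
  rw [← card_map Fin.valEmbedding, e, Nat.card_Ico, add_mul, one_mul, Nat.add_sub_cancel_left]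

theorem pairwise_disjoint_block (n b : ℕ) : Pairwise fun m m' =>
    Disjoint (block n b m : Set (Fin n)) (block n b m') := by
  refine fun m m' hm => Set.disjoint_left.2 fun x hx hx' => hm ?_
  simp only [block, coe_filter_univ, Set.mem_ofPred_eq] at hx hx'
  exact hx.symm.trans hx'

theorem disjoint_image2_iff {α β γ : Type*} {f : α → β → γ} (hf : Function.Injective2 f)
    {A A' : Set α} {B B' : Set β} :
    Disjoint (Set.image2 f A B) (Set.image2 f A' B') ↔ Disjoint A A' ∨ Disjoint B B' := by
  rw [← Set.image_uncurry_prod, ← Set.image_uncurry_prod, Set.disjoint_image_iff hf.uncurry,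
    Set.disjoint_prod]

/-- The event that the `m`-th block of the line `y` of the grid `g` contains an open point. -/
def blockEvent (g : Fin n → Fin n → V) (b m : ℕ) (y : Fin n) : Set (Set V) :=
  ⋃ x ∈ block n b m, {ω | g x y ∈ ω}

/-- The event that the line `y` has an open point in each of the `k` blocks from the `h`-th on. -/
def lineEvent (g : Fin n → Fin n → V) (b h k : ℕ) (y : Fin n) : Set (Set V) :=
  ⋂ l ∈ range k, blockEvent g b (h + l) y

/-- The event that, for every `i < h`, one of the lines of the `i`-th block has `h - i` open points
in distinct blocks beyond the first `h`. -/
def halfNucleation (g : Fin n → Fin n → V) (b h : ℕ) : Set (Set V) :=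
  ⋂ i ∈ range h, ⋃ y ∈ block n b i, lineEvent g b h (h - i) y

/-- The event that the grid `g` contains a nucleus, that is a half nucleus in either direction. -/
def nucleation (g : Fin n → Fin n → V) (b h : ℕ) : Set (Set V) :=
  halfNucleation g b h ∩ halfNucleation (fun x y => g y x) b h

theorem measurableSet_blockEvent :
    MeasurableSet[stateAlgebra (Set.image2 g (block n b m) {y})] (blockEvent g b m y) :=
  Finset.measurableSet_biUnion _ fun _ hx =>
    measurableSet_stateAlgebra_mem (Set.mem_image2_of_mem hx rfl)

theorem measurableSet_lineEvent :
    MeasurableSet[stateAlgebra (Set.image2 g {x | h ≤ x.val / b} {y})] (lineEvent g b h k y) := by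
  refine Finset.measurableSet_biInter _ fun l _ =>
    stateAlgebra_mono (Set.image2_subset_right fun x hx => ?_) _ measurableSet_blockEvent
  simp only [block, coe_filter_univ, Set.mem_ofPred_eq] at hx ⊢
  omega

theorem measurableSet_biUnion_lineEvent (A : Finset (Fin n)) :
    MeasurableSet[stateAlgebra (Set.image2 g {x | h ≤ x.val / b} A)]
      (⋃ y ∈ A, lineEvent g b h k y) :=
  Finset.measurableSet_biUnion _ fun _ hy => stateAlgebra_mono
    (Set.image2_subset_left (Set.singleton_subset_iff.2 hy)) _ measurableSet_lineEvent

theorem measurableSet_halfNucleation :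
    MeasurableSet[stateAlgebra (Set.image2 g {x | h ≤ x.val / b} {y | y.val / b < h})]
      (halfNucleation g b h) := by
  refine Finset.measurableSet_biInter _ fun i hi => stateAlgebra_mono
    (Set.image2_subset_left fun y hy => ?_) _ (measurableSet_biUnion_lineEvent _)
  simp only [block, coe_filter_univ, Set.mem_ofPred_eq] at hy ⊢
  exact hy ▸ mem_range.1 hi

theorem measurableSet_nucleation :
    MeasurableSet[stateAlgebra (Set.image2 g Set.univ Set.univ)] (nucleation g b h) :=
  MeasurableSet.inter
    (stateAlgebra_mono (Set.image2_subset (Set.subset_univ _) (Set.subset_univ _)) _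
      measurableSet_halfNucleation)
    (stateAlgebra_mono (Set.image2_swap g _ _ ▸
        Set.image2_subset (Set.subset_univ _) (Set.subset_univ _)) _
      measurableSet_halfNucleation)

/-- The probability of `halfNucleation` at density `p`. -/
noncomputable def halfNucleationProb (b h : ℕ) (p : ℝ) : ℝ :=
  ∏ i ∈ range h, (1 - (1 - (1 - (1 - p) ^ b) ^ (h - i)) ^ b)

section Probability
variable (hg : Function.Injective2 g) (hb : 0 < b)
include hg hb

theorem setBernoulli_real_blockEvent (hm : (m + 1) * b ≤ n) :
    setBer(Set.univ, p).real (blockEvent g b m y) = 1 - (1 - p : ℝ) ^ b := by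
  rw [blockEvent, setBernoulli_real_biUnion (C := fun x => {g x y})
    fun x _ => measurableSet_stateAlgebra_mem rfl]
  · simp only [setBernoulli_real_mem, prod_const, card_block hb hm]
  · exact fun x _ x' _ hx => Set.disjoint_singleton.2 fun e => hx (hg e).1

theorem setBernoulli_real_lineEvent (hk : (h + k) * b ≤ n) :
    setBer(Set.univ, p).real (lineEvent g b h k y) = (1 - (1 - p : ℝ) ^ b) ^ k := by
  rw [lineEvent, setBernoulli_real_biInter fun l _ => measurableSet_blockEvent]
  · rw [prod_congr rfl fun l hl => setBernoulli_real_blockEvent hg hb ?_, prod_const, card_range]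
    have := mem_range.1 hl
    exact (Nat.mul_le_mul_right b (by omega)).trans hk
  · exact fun l _ l' _ hl => (disjoint_image2_iff hg).2 <| .inl <|
      pairwise_disjoint_block n b (by simpa using hl)

theorem setBernoulli_real_biUnion_lineEvent (hk : (h + k) * b ≤ n) (hm : (m + 1) * b ≤ n) :
    setBer(Set.univ, p).real (⋃ y ∈ block n b m, lineEvent g b h k y) =
      1 - (1 - (1 - (1 - p : ℝ) ^ b) ^ k) ^ b := by
  rw [setBernoulli_real_biUnion fun y _ => measurableSet_lineEvent]
  · simp only [setBernoulli_real_lineEvent hg hb hk, prod_const, card_block hb hm]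
  · exact fun y _ y' _ hy => (disjoint_image2_iff hg).2 <| .inr <| Set.disjoint_singleton.2 hy

theorem setBernoulli_real_halfNucleation (hn : 2 * h * b ≤ n) :
    setBer(Set.univ, p).real (halfNucleation g b h) = halfNucleationProb b h p := by
  rw [halfNucleation, setBernoulli_real_biInter fun i _ => measurableSet_biUnion_lineEvent _]
  · refine prod_congr rfl fun i hi => ?_
    have := mem_range.1 hi
    exact setBernoulli_real_biUnion_lineEvent hg hb
      ((Nat.mul_le_mul_right b (by omega)).trans hn) ((Nat.mul_le_mul_right b (by omega)).trans hn)
  · exact fun i _ i' _ hi => (disjoint_image2_iff hg).2 <| .inr <| pairwise_disjoint_block n b hi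

theorem setBernoulli_real_nucleation (hn : 2 * h * b ≤ n) :
    setBer(Set.univ, p).real (nucleation g b h) = halfNucleationProb b h p ^ 2 := by
  have hg' : Function.Injective2 fun x y => g y x := fun _ _ _ _ e => (hg e).symm
  rw [nucleation, setBernoulli_real_inter ?_ measurableSet_halfNucleation
    measurableSet_halfNucleation, setBernoulli_real_halfNucleation hg hb hn,
    setBernoulli_real_halfNucleation hg' hb hn, sq]
  rw [Set.image2_swap (fun x y => g y x), disjoint_image2_iff hg]
  exact .inl (Set.disjoint_left.2 fun x (hx : h ≤ x / b) hx' => not_le_of_gt hx' hx)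

end Probability

theorem exists_isHalfNucleus {ω : Set V} [Nonempty (Fin n)] (hω : ω ∈ halfNucleation g b h) :
    ∃ ρ R, IsHalfNucleus {x : Fin n | x.val / b < h} h (fun x y => g x y ∈ ω) ρ R := by
  have points : ∀ i < h, ∃ y : Fin n, y.val / b = i ∧
      ∀ l < h - i, ∃ x : Fin n, x.val / b = h + l ∧ g x y ∈ ω := by
    simpa [halfNucleation, lineEvent, blockEvent, block] using hω
  choose! ρ block_ρ hx using points
  choose! x block_x open_x using hx
  refine ⟨ρ, fun i => (range (h - i)).image (x i), ?_, ?_, ?_, ?_, ?_⟩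
  · intro i hi j hj e
    rw [← block_ρ i hi, e, block_ρ j hj]
  · intro i hi
    rwa [Set.mem_ofPred_eq, block_ρ i hi]
  · simp only [forall_mem_image, mem_range, Set.mem_ofPred_eq, not_lt]
    exact fun i hi l hl => block_x i hi l hl ▸ Nat.le_add_right h l
  · intro i hi
    rw [card_image_of_injOn, card_range]
    intro l hl l' hl' e
    rw [mem_coe, mem_range] at hl hl'
    have := block_x i hi l hl
    rw [e, block_x i hi l' hl'] at this
    omega
  · simp only [forall_mem_image, mem_range]
    exact open_x

end Nucleation

section Planes
variable {n d θ b h : ℕ} {c₀ c₁ : Fin d}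

theorem nucleation_subset_eventuallyOpen (hc : c₀ ≠ c₁) (hθ : θ ≤ 2 * h) (w : Fin d → Fin n) :
    nucleation (cell c₀ c₁ w) b h ⊆ eventuallyOpen n d θ 2 := by
  rintro ω ⟨hω, hω'⟩
  refine ⟨_, isSubtorus_image2_cell hc w, ?_⟩
  rintro _ ⟨x, -, y, -, rfl⟩
  have : Nonempty (Fin n) := ⟨x⟩
  have initially_open := subset_finalConfig (hammingTorus n d) θ ω
  obtain ⟨ρ, R, hρ⟩ := exists_isHalfNucleus hω
  obtain ⟨γ, Q, hγ⟩ := exists_isHalfNucleus hω'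
  exact (gridClosed_finalConfig hc w ω).fill hθ (hρ.mono fun _ _ h => initially_open h)
    (hγ.mono fun _ _ h => initially_open h) x y

/-- One base point for each plane in the directions `c₀`, `c₁`. -/
def planeBases (c₀ c₁ : Fin d) (x₀ : Fin n) : Finset (Fin d → Fin n) :=
  Fintype.piFinset fun j => if j ∈ ({c₀, c₁} : Finset (Fin d)) then {x₀} else univ

theorem card_planeBases (hc : c₀ ≠ c₁) (x₀ : Fin n) : #(planeBases c₀ c₁ x₀) = n ^ (d - 2) := by
  simp only [planeBases, Fintype.card_piFinset, apply_ite card, card_singleton, card_univ,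
    Fintype.card_fin, prod_ite, prod_const_one, one_mul, prod_const]
  rw [filter_not, filter_univ_mem, card_sdiff_of_subset (subset_univ _), card_pair hc, card_fin]

theorem pairwiseDisjoint_planes (c₀ c₁ : Fin d) (x₀ : Fin n) :
    (planeBases c₀ c₁ x₀ : Set (Fin d → Fin n)).PairwiseDisjoint
      fun w => Set.image2 (cell c₀ c₁ w) Set.univ Set.univ := by
  refine fun w hw w' hw' hne => Set.disjoint_left.2 ?_
  rintro _ ⟨x, -, y, -, rfl⟩ ⟨x', -, y', -, e⟩
  refine hne (funext fun j => ?_)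
  rw [mem_coe, planeBases, Fintype.mem_piFinset] at hw hw'
  have base := hw j
  have base' := hw' j
  by_cases hj : j ∈ ({c₀, c₁} : Finset (Fin d))
  · rw [if_pos hj, mem_singleton] at base base'
    rw [base, base']
  · simp only [mem_insert, mem_singleton, not_or] at hj
    simpa only [cell_of_ne hj.1 hj.2] using (congrFun e j).symm

theorem le_openProb (p : unitInterval) (hd : 2 ≤ d) (hb : 0 < b) (hn₀ : 0 < n)
    (hn : 2 * h * b ≤ n) (hθ : θ ≤ 2 * h) :
    1 - (1 - halfNucleationProb b h p ^ 2) ^ n ^ (d - 2) ≤ openProb n d θ 2 p := by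
  have : Nontrivial (Fin d) := Fin.nontrivial_iff_two_le.2 hd
  obtain ⟨c₀, c₁, hc⟩ := exists_pair_ne (Fin d)
  have subset : ⋃ w ∈ planeBases c₀ c₁ ⟨0, hn₀⟩, nucleation (cell c₀ c₁ w) b h ⊆
      eventuallyOpen n d θ 2 :=
    Set.iUnion₂_subset fun w _ => nucleation_subset_eventuallyOpen hc hθ w
  refine le_trans (le_of_eq ?_) (measureReal_mono subset)
  rw [setBernoulli_real_biUnion (fun w _ => measurableSet_nucleation)
    (pairwiseDisjoint_planes c₀ c₁ _)]
  simp only [setBernoulli_real_nucleation (injective2_cell hc) hb hn, prod_const,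
    card_planeBases hc]

end Planes

section Supercritical
variable {x κ μ α a ε : ℝ} {b d h n θ : ℕ}

theorem one_sub_pow_le_exp_neg (hx : x ≤ 1) (b : ℕ) : (1 - x) ^ b ≤ Real.exp (-(b * x)) := by
  rw [← mul_neg, Real.exp_nat_mul]
  exact pow_le_pow_left₀ (sub_nonneg.2 hx) (Real.one_sub_le_exp_neg x) b

theorem min_div_two_le_one_sub_one_sub_pow (hx₀ : 0 ≤ x) (hx₁ : x ≤ 1) (b : ℕ) :
    min 1 (b * x) / 2 ≤ 1 - (1 - x) ^ b := by
  set y := b * x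
  have hy₀ : 0 ≤ y := by positivity
  have inv_bound : (1 - x) ^ b ≤ (1 + y)⁻¹ := by
    refine (one_sub_pow_le_exp_neg hx₁ b).trans ?_
    rw [Real.exp_neg]
    exact inv_anti₀ (by positivity) (add_comm 1 y ▸ Real.add_one_le_exp y)
  calc min 1 y / 2 ≤ y / (1 + y) := by
        rw [div_le_div_iff₀ two_pos (by positivity)]
        rcases min_cases 1 y with ⟨e, _⟩ | ⟨e, _⟩ <;> rw [e] <;> nlinarith
    _ = 1 - (1 + y)⁻¹ := by field_simp; ring
    _ ≤ 1 - (1 - x) ^ b := by gcongr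

theorem mul_rpow_le_one_sub_one_sub_pow (hn : 0 < n) (hκ₀ : 0 ≤ κ) (hκ₁ : κ ≤ 1) (hμ₀ : 0 ≤ μ)
    (hμ₁ : μ ≤ 1) (hb : μ * n ≤ b) (hx : κ * (n : ℝ) ^ (-α) ≤ x) (hx₁ : x ≤ 1) :
    κ * (μ / 2) * (n : ℝ) ^ (-max 0 (α - 1)) ≤ 1 - (1 - x) ^ b := by
  have hn₁ : (1 : ℝ) ≤ n := by exact_mod_cast hn
  have hx₀ : 0 ≤ x := le_trans (by positivity) hx
  refine le_trans ?_ (min_div_two_le_one_sub_one_sub_pow hx₀ hx₁ b)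
  rw [← mul_div_assoc, div_mul_eq_mul_div]
  gcongr
  refine le_min ?_ ?_
  · exact mul_le_one₀ (mul_le_one₀ hκ₁ hμ₀ hμ₁) (by positivity)
      (Real.rpow_le_one_of_one_le_of_nonpos hn₁ (by simp))
  · calc κ * μ * (n : ℝ) ^ (-max 0 (α - 1)) ≤ κ * μ * (n : ℝ) ^ (1 + -α) := by
          gcongr
          linarith [le_max_right 0 (α - 1)]
      _ = μ * n * (κ * (n : ℝ) ^ (-α)) := by
          rw [Real.rpow_add (by positivity), Real.rpow_one]; ring
      _ ≤ b * x := by gcongr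

/-- The exponent `S` for which a half nucleus exists at density `n ^ (-1 - a)` with probability of
order `n ^ (-S)`. -/
noncomputable def nucleationExponent (a : ℝ) (h : ℕ) : ℝ :=
  ∑ i ∈ range h, max 0 (a * (h - i : ℕ) - 1)

theorem le_halfNucleationProb {p : ℝ} (hn : 0 < n) (ha : 0 ≤ a) (hμ₀ : 0 ≤ μ) (hμ₁ : μ ≤ 1)
    (hb : μ * n ≤ b) (hp : (n : ℝ) ^ (-1 - a) ≤ p) (hp₁ : p ≤ 1) :
    ((μ / 2) ^ (h + 1)) ^ h * (n : ℝ) ^ (-nucleationExponent a h) ≤ halfNucleationProb b h p := by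
  have hn₀ : (0 : ℝ) < n := by exact_mod_cast hn
  set u := 1 - (1 - p) ^ b
  have hu₁ : u ≤ 1 := sub_le_self _ (pow_nonneg (sub_nonneg.2 hp₁) b)
  have block_bound : μ / 2 * (n : ℝ) ^ (-a) ≤ u := by
    have := mul_rpow_le_one_sub_one_sub_pow (κ := 1) (α := 1 + a) hn zero_le_one le_rfl hμ₀ hμ₁ hb
      (by rwa [one_mul, neg_add']) hp₁
    rwa [one_mul, add_sub_cancel_left, max_eq_right ha] at this
  have line_bound (k : ℕ) (hk : k ≤ h) : (μ / 2) ^ h * (n : ℝ) ^ (-(a * k)) ≤ u ^ k :=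
    calc (μ / 2) ^ h * (n : ℝ) ^ (-(a * k)) ≤ (μ / 2) ^ k * (n : ℝ) ^ (-(a * k)) := by
          gcongr ?_ * _
          exact pow_le_pow_of_le_one (by positivity) (by linarith) hk
      _ = (μ / 2 * (n : ℝ) ^ (-a)) ^ k := by
          rw [mul_pow, ← Real.rpow_mul_natCast hn₀.le, neg_mul]
      _ ≤ u ^ k := by gcongr
  rw [nucleationExponent, ← sum_neg_distrib, Real.rpow_sum_of_pos hn₀]
  nth_rewrite 2 [← card_range h]
  rw [← prod_const, ← prod_mul_distrib]
  refine prod_le_prod (fun i _ => by positivity) fun i _ => ?_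
  rw [pow_succ]
  exact mul_rpow_le_one_sub_one_sub_pow hn (by positivity)
    (pow_le_one₀ (by positivity) (by linarith)) hμ₀ hμ₁ hb (line_bound _ (Nat.sub_le h i))
    (pow_le_one₀ (le_trans (by positivity) block_bound) hu₁)

theorem one_sub_one_sub_pow_mem_Icc (hx : x ∈ Set.Icc 0 1) (b : ℕ) :
    1 - (1 - x) ^ b ∈ Set.Icc 0 1 :=
  have := Set.Icc.one_sub_mem hx
  Set.Icc.one_sub_mem ⟨pow_nonneg this.1 b, pow_le_one₀ this.1 this.2⟩

theorem halfNucleationProb_mem_Icc (hx : x ∈ Set.Icc 0 1) :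
    halfNucleationProb b h x ∈ Set.Icc 0 1 := by
  have factor (i : ℕ) : 1 - (1 - (1 - (1 - x) ^ b) ^ (h - i)) ^ b ∈ Set.Icc (0 : ℝ) 1 := by
    have := one_sub_one_sub_pow_mem_Icc hx b
    exact one_sub_one_sub_pow_mem_Icc ⟨pow_nonneg this.1 _, pow_le_one₀ this.1 this.2⟩ b
  exact ⟨prod_nonneg fun i _ => (factor i).1,
    prod_le_one (fun i _ => (factor i).1) fun i _ => (factor i).2⟩

theorem eventually_lt_openProb (hd : 2 ≤ d) (hθ : θ ≤ 2 * h) (hh : 0 < h) (ha : 0 ≤ a)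
    (hS : 2 * nucleationExponent a h < d - 2) (hε : 0 < ε) :
    ∀ᶠ n : ℕ in atTop, ∀ p : unitInterval, (n : ℝ) ^ (-1 - a) ≤ p → 1 - ε < openProb n d θ 2 p := by
  set S := nucleationExponent a h
  set μ : ℝ := 1 / (4 * h) with hμ
  set K : ℝ := ((μ / 2) ^ (h + 1)) ^ h
  have hh₁ : (1 : ℝ) ≤ h := by exact_mod_cast hh
  have decay : Tendsto (fun n : ℕ => Real.exp (-(K ^ 2 * (n : ℝ) ^ (d - 2 - 2 * S)))) atTop (𝓝 0) :=
    Real.tendsto_exp_neg_atTop_nhds_zero.comp <|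
      ((tendsto_rpow_atTop (by linarith)).comp tendsto_natCast_atTop_atTop).const_mul_atTop
        (by positivity)
  filter_upwards [decay.eventually_lt_const hε, eventually_ge_atTop (2 * h)] with n hn hnh p hp
  have hn₀ : 0 < n := by omega
  set b := n / (2 * h)
  have hb : μ * n ≤ b := by
    have : n ≤ 4 * h * b := by
      have := Nat.lt_mul_div_succ n (show 0 < 2 * h by omega)
      have := Nat.mul_le_mul_left (2 * h) (Nat.div_pos hnh (by omega))
      grind
    rw [hμ, one_div_mul_eq_div, div_le_iff₀' (by positivity)]
    exact_mod_cast this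
  have hμ₁ : μ ≤ 1 := (div_le_one (by positivity)).2 (by linarith)
  set q := halfNucleationProb b h p
  have hq : K * (n : ℝ) ^ (-S) ≤ q :=
    le_halfNucleationProb hn₀ ha (by positivity) hμ₁ hb hp p.2.2
  have hq₁ : q ^ 2 ≤ 1 :=
    have := halfNucleationProb_mem_Icc p.2
    pow_le_one₀ this.1 this.2
  have dim : ((d - 2 : ℕ) : ℝ) = d - 2 := by push_cast [hd]; rfl
  have failure : (1 - q ^ 2) ^ n ^ (d - 2) < ε :=
    calc (1 - q ^ 2) ^ n ^ (d - 2) ≤ Real.exp (-((n ^ (d - 2) : ℕ) * q ^ 2)) :=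
          one_sub_pow_le_exp_neg hq₁ _
      _ ≤ Real.exp (-((n ^ (d - 2) : ℕ) * (K * (n : ℝ) ^ (-S)) ^ 2)) := by gcongr
      _ = Real.exp (-(K ^ 2 * (n : ℝ) ^ (d - 2 - 2 * S))) := by
          rw [sub_eq_add_neg (d - 2 : ℝ), Real.rpow_add (by exact_mod_cast hn₀), mul_pow,
            ← Real.rpow_mul_natCast n.cast_nonneg, ← dim, Real.rpow_natCast]
          push_cast
          ring_nf
      _ < ε := hn
  exact (sub_lt_sub_left failure 1).trans_le
    (le_openProb p hd (Nat.div_pos hnh (by omega)) hn₀ (Nat.mul_div_le _ _) hθ)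

theorem nucleationExponent_le (ha : 0 < a) (h : ℕ) :
    nucleationExponent a h ≤ max 0 (a * h - 1) ^ 2 / (2 * a) + max 0 (a * h - 1) := by
  induction h with
  | zero => simp [nucleationExponent]
  | succ h ih =>
    set y := a * h - 1
    have shift : a * (h + 1 : ℕ) - 1 = y + a := by push_cast; ring
    have increment : max 0 y ^ 2 / (2 * a) + max 0 y ≤ max 0 (y + a) ^ 2 / (2 * a) := by
      rcases le_total 0 y with hy₀ | hy₀
      · rw [max_eq_right hy₀, max_eq_right (by linarith), div_add' _ _ _ (by positivity)]
        gcongr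
        nlinarith
      · rw [max_eq_left hy₀, zero_pow two_ne_zero, zero_div, zero_add]
        positivity
    rw [nucleationExponent, sum_range_succ']
    simp only [Nat.add_sub_add_right, Nat.sub_zero]
    rw [← nucleationExponent, shift]
    exact add_le_add_left (ih.trans increment) _

/-- The exponent `a` at which `n ^ (-1 - a)` is the density of the theorem with the constant `c` in
the term of second order. -/
noncomputable def excessExponent (c : ℝ) (θ : ℕ) : ℝ := 2 / θ + c / (θ : ℝ) ^ (3 / 2 : ℝ)

theorem excessExponent_eq (c : ℝ) (θ : ℕ) : excessExponent c θ = 2 / √θ ^ 2 + c / √θ ^ 3 := by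
  rw [excessExponent, ← Real.rpow_natCast √θ 3, ← Real.rpow_div_two_eq_sqrt _ θ.cast_nonneg,
    Real.sq_sqrt θ.cast_nonneg, Nat.cast_ofNat]

theorem tendsto_sqrt_natCast_atTop : Tendsto (fun θ : ℕ => √(θ : ℝ)) atTop atTop :=
  Real.tendsto_sqrt_atTop.comp tendsto_natCast_atTop_atTop

theorem nucleationExponent_excessExponent_le {c : ℝ} (hc : 0 ≤ c) (hθ : 0 < θ) :
    2 * nucleationExponent (excessExponent c θ) ((θ + 1) / 2) ≤
      (c / 2 + (√θ)⁻¹ + c / 2 * (√θ)⁻¹ ^ 2) ^ 2 / 2 +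
        2 * ((√θ)⁻¹ * (c / 2 + (√θ)⁻¹ + c / 2 * (√θ)⁻¹ ^ 2)) := by
  set t := √(θ : ℝ) with ht
  have ht₀ : 0 < t := Real.sqrt_pos.2 (by exact_mod_cast hθ)
  have htθ : (θ : ℝ) = t ^ 2 := (Real.sq_sqrt θ.cast_nonneg).symm
  set φ := c / 2 + t⁻¹ + c / 2 * t⁻¹ ^ 2 with hφ
  have hφ₀ : 0 ≤ φ := by positivity
  rw [excessExponent_eq, ← ht]
  set a := 2 / t ^ 2 + c / t ^ 3 with ha
  have lower : 2 / t ^ 2 ≤ a := le_add_of_nonneg_right (by positivity)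
  have ha₀ : 0 < a := lt_of_lt_of_le (by positivity) lower
  have upper : max 0 (a * ((θ + 1) / 2 : ℕ) - 1) ≤ t⁻¹ * φ := by
    refine max_le (by positivity) ?_
    calc a * ((θ + 1) / 2 : ℕ) - 1 ≤ a * ((t ^ 2 + 1) / 2) - 1 := by
          gcongr
          exact Nat.cast_div_le.trans_eq (by push_cast; rw [htθ])
      _ = t⁻¹ * φ := by rw [ha, hφ]; field_simp; ring
  calc 2 * nucleationExponent a ((θ + 1) / 2) ≤ 2 * ((t⁻¹ * φ) ^ 2 / (2 * a) + t⁻¹ * φ) := by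
        grw [nucleationExponent_le ha₀, upper]
    _ ≤ 2 * ((t⁻¹ * φ) ^ 2 / (2 * (2 / t ^ 2)) + t⁻¹ * φ) := by grw [lower]
    _ = φ ^ 2 / 2 + 2 * (t⁻¹ * φ) := by field_simp

theorem eventually_nucleationExponent_lt {c e : ℝ} (hc : 0 ≤ c) (he : c ^ 2 / 8 < e) :
    ∀ᶠ θ : ℕ in atTop, 2 * nucleationExponent (excessExponent c θ) ((θ + 1) / 2) < e := by
  have limit : Tendsto (fun θ : ℕ => (c / 2 + (√θ)⁻¹ + c / 2 * (√θ)⁻¹ ^ 2) ^ 2 / 2 +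
      2 * ((√θ)⁻¹ * (c / 2 + (√θ)⁻¹ + c / 2 * (√θ)⁻¹ ^ 2))) atTop (𝓝 (c ^ 2 / 8)) := by
    have continuous : Continuous fun z : ℝ =>
        (c / 2 + z + c / 2 * z ^ 2) ^ 2 / 2 + 2 * (z * (c / 2 + z + c / 2 * z ^ 2)) := by fun_prop
    exact (continuous.tendsto' 0 (c ^ 2 / 8) (by ring)).comp
      tendsto_sqrt_natCast_atTop.inv_tendsto_atTop
  filter_upwards [limit.eventually_lt_const he, eventually_gt_atTop 0] with θ hθ hθ₀
  exact (nucleationExponent_excessExponent_le hc hθ₀).trans_lt hθ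

end Supercritical

section Matching
variable {α β : Type*} {k : ℕ}

/-- No two points of `M` lie on a common line of the grid `α × β`. -/
def IsGridMatching (M : Finset (α × β)) : Prop :=
  Set.InjOn Prod.fst (M : Set (α × β)) ∧ Set.InjOn Prod.snd (M : Set (α × β))

theorem IsGridMatching.insert [DecidableEq α] [DecidableEq β] {M : Finset (α × β)} {z : α × β}
    (hM : IsGridMatching M) (h₁ : z.1 ∉ M.image Prod.fst) (h₂ : z.2 ∉ M.image Prod.snd) :
    IsGridMatching (insert z M) := by
  have hz : z ∉ (M : Set (α × β)) := fun hz => h₁ (mem_image_of_mem _ hz)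
  rw [IsGridMatching, coe_insert, Set.injOn_insert hz, Set.injOn_insert hz, ← coe_image,
    ← coe_image]
  exact ⟨⟨hM.1, h₁⟩, hM.2, h₂⟩

theorem IsGridMatching.mono {M M' : Finset (α × β)} (hM : IsGridMatching M) (h : M' ⊆ M) :
    IsGridMatching M' :=
  ⟨hM.1.mono (coe_subset.2 h), hM.2.mono (coe_subset.2 h)⟩

theorem exists_cover_of_isGridMatching_card_lt [Finite α] [Finite β] {P : α × β → Prop}
    (h : ∀ M : Finset (α × β), IsGridMatching M → (∀ z ∈ M, P z) → #M < k) :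
    ∃ (X : Finset α) (Y : Finset β), #X < k ∧ #Y < k ∧ ∀ z, P z → z.1 ∈ X ∨ z.2 ∈ Y := by
  classical
  obtain ⟨M, ⟨hM, hP⟩, maximal⟩ :=
    {M : Finset (α × β) | IsGridMatching M ∧ ∀ z ∈ M, P z}.toFinite.exists_maximal
      ⟨∅, by simp [IsGridMatching]⟩
  refine ⟨M.image Prod.fst, M.image Prod.snd, card_image_le.trans_lt (h M hM hP),
    card_image_le.trans_lt (h M hM hP), fun z hz => ?_⟩
  by_contra! hcover
  have mem : z ∈ M := maximal ⟨hM.insert hcover.1 hcover.2, forall_mem_insert .. |>.2 ⟨hz, hP⟩⟩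
    (subset_insert z M) (mem_insert_self z M)
  exact hcover.1 (mem_image_of_mem _ mem)

end Matching

section Barrier
variable {n d θ T k : ℕ} {ω : Set (Fin d → Fin n)} {v : Fin d → Fin n} {j j' : Fin d}

/-- The vertex `v` has at least `T` open neighbours. -/
def IsRich (ω : Set (Fin d → Fin n)) (T : ℕ) (v : Fin d → Fin n) : Prop :=
  T ≤ ((hammingTorus n d).neighborSet v ∩ ω).ncard

/-- The positions of the rich vertices on the line through `v` in direction `j`. -/
def richOnLine (ω : Set (Fin d → Fin n)) (T : ℕ) (v : Fin d → Fin n) (j : Fin d) : Set (Fin n) :=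
  {x | IsRich ω T (Function.update v j x)}

/-- The line through `v` in direction `j` contains at least `k` rich vertices. -/
def IsHeavy (ω : Set (Fin d → Fin n)) (T k : ℕ) (v : Fin d → Fin n) (j : Fin d) : Prop :=
  k ≤ (richOnLine ω T v j).ncard

/-- The open vertices, the rich vertices and all heavy lines. -/
def barrier (ω : Set (Fin d → Fin n)) (T k : ℕ) : Set (Fin d → Fin n) :=
  ω ∪ {v | IsRich ω T v ∨ ∃ j, IsHeavy ω T k v j}

/-- No plane contains `k` rich vertices in general position. -/
def NoRichMatching (ω : Set (Fin d → Fin n)) (T k : ℕ) : Prop :=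
  ∀ c₀ c₁ : Fin d, c₀ ≠ c₁ → ∀ (w : Fin d → Fin n) (M : Finset (Fin n × Fin n)),
    IsGridMatching M → (∀ z ∈ M, IsRich ω T (cell c₀ c₁ w z.1 z.2)) → #M < k

theorem isHeavy_update_iff {x : Fin n} :
    IsHeavy ω T k (Function.update v j x) j ↔ IsHeavy ω T k v j := by
  simp only [IsHeavy, richOnLine, Function.update_idem]

theorem isRich_update (hT : T + {x | Function.update v j x ∉ ω}.ncard < n) (x : Fin n) :
    IsRich ω T (Function.update v j x) := by
  set L := {y | Function.update v j y ∈ ω}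
  have subset : Function.update v j '' (L \ {x}) ⊆
      (hammingTorus n d).neighborSet (Function.update v j x) ∩ ω := by
    rintro _ ⟨y, ⟨hy, hne⟩, rfl⟩
    exact ⟨hammingTorus_adj_iff.2 ⟨j, y, by rwa [Function.update_self], by
      rw [Function.update_idem]⟩, hy⟩
  have card_line : L.ncard + {x | Function.update v j x ∉ ω}.ncard = n := by
    rw [← Set.compl_ofPred, Set.ncard_add_ncard_compl, Nat.card_fin]
  have card_rest := Set.ncard_le_ncard_sdiff_add_ncard L {x}
  rw [Set.ncard_singleton] at card_rest
  have rest_le := Set.ncard_le_ncard subset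
  rw [Set.ncard_image_of_injective _ (Function.update_injective v j)] at rest_le
  rw [IsRich]
  omega

namespace NoRichMatching

theorem exists_heavy_cover (h : NoRichMatching ω T k) (hj : j ≠ j') (v : Fin d → Fin n) :
    ∃ X : Finset (Fin n), #X < k ∧ ∀ x, IsHeavy ω T k (Function.update v j x) j' → x ∈ X := by
  obtain ⟨X, Y, hX, hY, cover⟩ := exists_cover_of_isGridMatching_card_lt (h j j' hj v)
  refine ⟨X, hX, fun x heavy => ?_⟩
  by_contra hx
  have subset : richOnLine ω T (Function.update v j x) j' ⊆ Y := fun y hy =>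
    (cover (x, y) hy).resolve_left hx
  have := Set.ncard_le_ncard subset
  rw [Set.ncard_coe_finset] at this
  exact absurd (heavy.trans this) (not_le_of_gt hY)

theorem ncard_barrier_sdiff_le (h : NoRichMatching ω T k) (hv : ¬ IsHeavy ω T k v j) :
    {x | Function.update v j x ∈ barrier ω T k \ ω}.ncard ≤ d * k := by
  have heavy_cover (j' : Fin d) : ∃ X : Finset (Fin n), #X ≤ k ∧
      ∀ x, j ≠ j' → IsHeavy ω T k (Function.update v j x) j' → x ∈ X := by
    by_cases hj : j = j'
    · exact ⟨∅, Nat.zero_le k, fun _ hne => absurd hj hne⟩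
    · obtain ⟨X, hX, cover⟩ := h.exists_heavy_cover hj v
      exact ⟨X, hX.le, fun x _ => cover x⟩
  choose X hX cover using heavy_cover
  have subset : {x | Function.update v j x ∈ barrier ω T k \ ω} ⊆
      richOnLine ω T v j ∪ ((univ.erase j).biUnion X : Finset (Fin n)) := by
    rintro x ⟨hx | hx | ⟨j', hx⟩, hxω⟩
    · exact absurd hx hxω
    · exact Or.inl hx
    · have hj : j ≠ j' := by
        rintro rfl
        exact hv (isHeavy_update_iff.1 hx)
      exact Or.inr (mem_biUnion.2 ⟨j', mem_erase.2 ⟨hj.symm, mem_univ j'⟩, cover j' x hj hx⟩)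
  calc {x | Function.update v j x ∈ barrier ω T k \ ω}.ncard
      ≤ (richOnLine ω T v j).ncard + #((univ.erase j).biUnion X) := by
        grw [Set.ncard_le_ncard subset, Set.ncard_union_le, Set.ncard_coe_finset]
    _ ≤ k + (d - 1) * k := by
        refine Nat.add_le_add (not_le.1 hv).le ?_
        refine (card_biUnion_le_card_mul _ X k fun j' _ => hX j').trans_eq ?_
        rw [card_erase_of_mem (mem_univ j), card_fin]
    _ = d * k := by
        rw [add_comm, ← Nat.succ_mul, Nat.succ_eq_add_one, Nat.sub_add_cancel j.pos]

theorem step_barrier_subset (h : NoRichMatching ω T k) (hT : T + d ^ 2 * k ≤ θ) :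
    step (hammingTorus n d) θ (barrier ω T k) ⊆ barrier ω T k := by
  rintro v (hv | hv)
  · exact hv
  by_contra hvB
  simp only [barrier, Set.mem_union, Set.mem_ofPred_eq, not_or, not_exists] at hvB
  obtain ⟨-, poor, light⟩ := hvB
  have subset : (hammingTorus n d).neighborSet v ∩ barrier ω T k ⊆
      (hammingTorus n d).neighborSet v ∩ ω ∪
        ⋃ j, Function.update v j '' {x | Function.update v j x ∈ barrier ω T k \ ω} := by
    rintro u ⟨hu, huB⟩
    by_cases huω : u ∈ ω
    · exact Or.inl ⟨hu, huω⟩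
    · obtain ⟨j, x, -, rfl⟩ := hammingTorus_adj_iff.1 hu
      exact Or.inr (Set.mem_iUnion.2 ⟨j, x, ⟨huB, huω⟩, rfl⟩)
  have excess :
      (⋃ j, Function.update v j '' {x | Function.update v j x ∈ barrier ω T k \ ω}).ncard ≤
        d ^ 2 * k :=
    calc _ ≤ ∑ j, (Function.update v j '' {x | Function.update v j x ∈ barrier ω T k \ ω}).ncard :=
          Set.ncard_iUnion_le_of_fintype _
      _ ≤ ∑ _j : Fin d, d * k := sum_le_sum fun j _ =>
          (Set.ncard_image_le (Set.toFinite _)).trans (h.ncard_barrier_sdiff_le (light j))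
      _ = d ^ 2 * k := by rw [sum_const, card_fin, smul_eq_mul, sq, mul_assoc]
  have few : ((hammingTorus n d).neighborSet v ∩ barrier ω T k).ncard < θ := by
    have := (Set.ncard_le_ncard subset).trans (Set.ncard_union_le _ _)
    have := not_le.1 poor
    omega
  rw [← (Set.toFinite _).cast_ncard_eq, Nat.cast_le] at hv
  exact absurd hv (not_le_of_gt few)

theorem notMem_eventuallyOpen (h : NoRichMatching ω T k) (hT : T + d ^ 2 * k ≤ θ) (hn : θ < n) :
    ω ∉ eventuallyOpen n d θ 2 := by
  rintro ⟨_, ⟨I, w, hI, rfl⟩, plane_subset⟩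
  obtain ⟨j, j', hj, rfl⟩ := card_eq_two.1 hI
  have hdk : d * k ≤ d ^ 2 * k := Nat.mul_le_mul_right k (Nat.le_self_pow two_ne_zero d)
  have hk : k ≤ d * k := Nat.le_mul_of_pos_left k j.pos
  obtain ⟨X, hX, cover⟩ := h.exists_heavy_cover hj.symm w
  obtain ⟨y, hy⟩ : ∃ y, y ∉ X := by
    by_contra! all_mem
    rw [eq_univ_iff_forall.2 all_mem, card_fin] at hX
    omega
  set v := Function.update w j' y
  have light : ¬ IsHeavy ω T k v j := fun heavy => hy (cover y heavy)
  have line_subset (x : Fin n) : Function.update v j x ∈ barrier ω T k := by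
    refine finalConfig_subset (θ := θ) Set.subset_union_left (h.step_barrier_subset hT)
      (plane_subset fun i hi => ?_)
    simp only [mem_insert, mem_singleton, not_or] at hi
    rw [Function.update_of_ne hi.1]
    exact Function.update_of_ne hi.2 _ _
  have few_closed := h.ncard_barrier_sdiff_le light
  simp only [Set.mem_sdiff, line_subset, true_and] at few_closed
  have all_rich : richOnLine ω T v j = Set.univ :=
    Set.eq_univ_of_forall (isRich_update (by omega))
  rw [IsHeavy, all_rich, Set.ncard_univ, Nat.card_fin] at light
  omega

end NoRichMatching

end Barrier

section ManyOpen
variable {V : Type*} [Finite V] {p : unitInterval} {C : Set V} {N : ℕ}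

/-- The event that at least `N` vertices of `C` are open. -/
def manyOpen (C : Set V) (N : ℕ) : Set (Set V) := {ω | N ≤ (C ∩ ω).ncard}

theorem manyOpen_coe_eq_biUnion (C : Finset V) (N : ℕ) :
    manyOpen (C : Set V) N = ⋃ A ∈ powersetCard N C, {ω | (A : Set V) ⊆ ω} := by
  ext ω
  simp only [manyOpen, Set.mem_ofPred_eq, Set.mem_iUnion, mem_powersetCard, exists_prop]
  constructor
  · intro h
    obtain ⟨A, hA, rfl⟩ := Set.exists_subset_card_eq h
    lift A to Finset V using A.toFinite
    exact ⟨A, ⟨coe_subset.1 fun _ hv => (hA hv).1, (Set.ncard_coe_finset A).symm⟩,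
      fun _ hv => (hA hv).2⟩
  · rintro ⟨A, ⟨hA, rfl⟩, hω⟩
    exact (Set.ncard_coe_finset A).symm.trans_le
      (Set.ncard_le_ncard (Set.subset_inter (coe_subset.2 hA) hω))

theorem measurableSet_manyOpen : MeasurableSet[stateAlgebra C] (manyOpen C N) := by
  lift C to Finset V using C.toFinite
  rw [manyOpen_coe_eq_biUnion]
  refine Finset.measurableSet_biUnion _ fun A hA => ?_
  have : {ω | (A : Set V) ⊆ ω} = ⋂ v ∈ A, {ω | v ∈ ω} := by ext; simp [Set.subset_def]
  rw [this]
  exact Finset.measurableSet_biInter _ fun v hv =>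
    measurableSet_stateAlgebra_mem ((mem_powersetCard.1 hA).1 hv)

theorem setBernoulli_real_manyOpen_le :
    setBer(Set.univ, p).real (manyOpen C N) ≤ (C.ncard * p : ℝ) ^ N := by
  lift C to Finset V using C.toFinite
  rw [manyOpen_coe_eq_biUnion, Set.ncard_coe_finset, mul_pow]
  calc _ ≤ ∑ A ∈ powersetCard N C, setBer(Set.univ, p).real {ω | (A : Set V) ⊆ ω} :=
        measureReal_biUnion_finset_le _ _
    _ = (#C).choose N * (p : ℝ) ^ N := by
        rw [sum_congr rfl fun A hA => (mem_powersetCard.1 hA).2 ▸ setBernoulli_real_superset p A,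
          sum_const, card_powersetCard, nsmul_eq_mul]
    _ ≤ #C ^ N * (p : ℝ) ^ N := by
        have := p.2.1
        gcongr
        exact_mod_cast Nat.choose_le_pow _ _

end ManyOpen

section PrivateNeighbors
variable {V : Type*} {G : SimpleGraph V} {M : Finset V} {v : V} {m D N T : ℕ} {p : unitInterval}

/-- The neighbours of `v` that are adjacent to no other vertex of `M`. -/
def privateNeighbors (G : SimpleGraph V) (M : Finset V) (v : V) : Set V :=
  {u ∈ G.neighborSet v | ∀ v' ∈ M, G.Adj v' u → v' = v}

theorem pairwiseDisjoint_privateNeighbors :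
    (M : Set V).PairwiseDisjoint (privateNeighbors G M) :=
  fun _ hv _ _ hne => Set.disjoint_left.2 fun _ hu hu' => hne (hu'.2 _ hv hu.1)

variable [Finite V]

theorem ncard_neighborSet_sdiff_privateNeighbors_le
    (h : ∀ v' ∈ M, v ≠ v' → (G.commonNeighbors v v').ncard ≤ m) :
    (G.neighborSet v \ privateNeighbors G M v).ncard ≤ m * #M := by
  classical
  have subset : G.neighborSet v \ privateNeighbors G M v ⊆
      ⋃ v' ∈ M.erase v, G.commonNeighbors v v' := by
    rintro u ⟨hu, hshared⟩
    simp only [privateNeighbors, Set.mem_ofPred_eq, hu, true_and, not_forall] at hshared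
    obtain ⟨v', hv', hu', hne⟩ := hshared
    exact Set.mem_biUnion (mem_erase.2 ⟨hne, hv'⟩) ⟨hu, hu'⟩
  calc (G.neighborSet v \ privateNeighbors G M v).ncard
      ≤ ∑ v' ∈ M.erase v, (G.commonNeighbors v v').ncard :=
        (Set.ncard_le_ncard subset).trans (set_ncard_biUnion_le _ _)
    _ ≤ #(M.erase v) * m := sum_le_card_nsmul _ _ _ fun v' hv' =>
        h v' (mem_of_mem_erase hv') (ne_of_mem_erase hv').symm
    _ ≤ m * #M := by grw [card_erase_le, mul_comm]

theorem manyOpen_neighborSet_subset (hT : N + m * #M ≤ T)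
    (h : ∀ v' ∈ M, v ≠ v' → (G.commonNeighbors v v').ncard ≤ m) :
    manyOpen (G.neighborSet v) T ⊆ manyOpen (privateNeighbors G M v) N := by
  intro ω (hω : T ≤ (G.neighborSet v ∩ ω).ncard)
  have subset : G.neighborSet v ∩ ω ⊆
      privateNeighbors G M v ∩ ω ∪ G.neighborSet v \ privateNeighbors G M v := by
    rintro u ⟨hu, huω⟩
    by_cases hp : u ∈ privateNeighbors G M v
    · exact Or.inl ⟨hp, huω⟩
    · exact Or.inr ⟨hu, hp⟩
  have := (Set.ncard_le_ncard subset).trans (Set.ncard_union_le _ _)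
  have := ncard_neighborSet_sdiff_privateNeighbors_le h
  rw [manyOpen, Set.mem_ofPred_eq]
  omega

theorem setBernoulli_real_biInter_manyOpen_neighborSet_le (hT : N + m * #M ≤ T)
    (hD : ∀ v, (G.neighborSet v).ncard ≤ D)
    (h : (M : Set V).Pairwise fun v v' => (G.commonNeighbors v v').ncard ≤ m) :
    setBer(Set.univ, p).real (⋂ v ∈ M, manyOpen (G.neighborSet v) T) ≤
      (D * p : ℝ) ^ (#M * N) := by
  have subset : ⋂ v ∈ M, manyOpen (G.neighborSet v) T ⊆
      ⋂ v ∈ M, manyOpen (privateNeighbors G M v) N :=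
    Set.iInter₂_mono fun v hv => manyOpen_neighborSet_subset hT fun v' hv' => h hv hv'
  calc _ ≤ ∏ v ∈ M, setBer(Set.univ, p).real (manyOpen (privateNeighbors G M v) N) :=
        (measureReal_mono subset).trans_eq (setBernoulli_real_biInter
          (fun v _ => measurableSet_manyOpen) pairwiseDisjoint_privateNeighbors)
    _ ≤ ∏ _v ∈ M, (D * p : ℝ) ^ N := by
        refine prod_le_prod (fun _ _ => measureReal_nonneg) fun v _ => ?_
        refine setBernoulli_real_manyOpen_le.trans ?_
        have := p.2.1
        gcongr
        exact (Set.ncard_le_ncard (Set.sep_subset _ _)).trans (hD v)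
    _ = (D * p : ℝ) ^ (#M * N) := by rw [prod_const, ← pow_mul, mul_comm N]

end PrivateNeighbors

section Subcritical
variable {n d θ k N T : ℕ} {c₀ c₁ : Fin d} {v v' : Fin d → Fin n} {a ε : ℝ}

theorem ncard_neighborSet_hammingTorus_le (v : Fin d → Fin n) :
    ((hammingTorus n d).neighborSet v).ncard ≤ d * n := by
  have subset : (hammingTorus n d).neighborSet v ⊆
      Set.range fun jx : Fin d × Fin n => Function.update v jx.1 jx.2 := by
    intro u hu
    obtain ⟨j, x, -, rfl⟩ := hammingTorus_adj_iff.1 hu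
    exact ⟨(j, x), rfl⟩
  calc _ ≤ _ := Set.ncard_le_ncard subset
    _ ≤ Nat.card (Fin d × Fin n) := by
      rw [← Set.image_univ, ← Set.ncard_univ]
      exact Set.ncard_image_le (Set.toFinite _)
    _ = d * n := by simp

theorem ncard_commonNeighbors_hammingTorus_le (hc : c₀ ≠ c₁) (h₀ : v c₀ ≠ v' c₀)
    (h₁ : v c₁ ≠ v' c₁) : ((hammingTorus n d).commonNeighbors v v').ncard ≤ 2 := by
  have subset : (hammingTorus n d).commonNeighbors v v' ⊆
      {Function.update v c₀ (v' c₀), Function.update v c₁ (v' c₁)} := by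
    rintro u ⟨hu, hu'⟩
    obtain ⟨j, x, -, rfl⟩ := hammingTorus_adj_iff.1 hu
    obtain ⟨j', x', -, e⟩ := hammingTorus_adj_iff.1 hu'
    have moved {c : Fin d} (hc : v c ≠ v' c) (hj' : c ≠ j') :
        Function.update v j x = Function.update v c (v' c) := by
      have hx := congrFun e c
      rw [Function.update_of_ne hj'] at hx
      obtain rfl : c = j := by
        by_contra hj
        exact hc (by rwa [Function.update_of_ne hj] at hx)
      rw [Function.update_self] at hx
      rw [hx]
    by_cases hj' : c₀ = j'
    · exact Or.inr (moved h₁ (hj' ▸ hc.symm))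
    · exact Or.inl (moved h₀ hj')
  exact (Set.ncard_le_ncard subset).trans ((Set.ncard_insert_le _ _).trans_eq (by simp))

theorem setBernoulli_real_rich_le (p : unitInterval) {M : Finset (Fin n × Fin n)} (hc : c₀ ≠ c₁)
    (w : Fin d → Fin n) (hM : IsGridMatching M) (hT : N + 2 * #M ≤ T) :
    setBer(Set.univ, p).real {ω | ∀ z ∈ M, IsRich ω T (cell c₀ c₁ w z.1 z.2)} ≤
      (d * n * p : ℝ) ^ (#M * N) := by
  let f : Fin n × Fin n → Fin d → Fin n := fun z => cell c₀ c₁ w z.1 z.2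
  have hf : Function.Injective f := (injective2_cell hc).uncurry
  have few_common : (M.image f : Set (Fin d → Fin n)).Pairwise fun v v' =>
      ((hammingTorus n d).commonNeighbors v v').ncard ≤ 2 := by
    rw [coe_image, hf.injOn.pairwise_image]
    intro z hz z' hz' hne
    refine ncard_commonNeighbors_hammingTorus_le hc (c₀ := c₀) (c₁ := c₁) ?_ ?_
    · simpa only [f, Function.onFun, cell_fst hc] using hM.1.ne hz hz' hne
    · simpa only [f, Function.onFun, cell_snd] using hM.2.ne hz hz' hne
  have event : {ω | ∀ z ∈ M, IsRich ω T (cell c₀ c₁ w z.1 z.2)} =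
      ⋂ v ∈ M.image f, manyOpen ((hammingTorus n d).neighborSet v) T := by
    rw [set_biInter_finset_image]
    ext ω
    simp [f, manyOpen, IsRich]
  have card_image := card_image_of_injective M hf
  rw [event, ← card_image]
  exact_mod_cast setBernoulli_real_biInter_manyOpen_neighborSet_le (by rwa [card_image])
    ncard_neighborSet_hammingTorus_le few_common

theorem openProb_le (p : unitInterval) (hθ : N + (d ^ 2 + 2) * k ≤ θ) (hn : θ < n) :
    openProb n d θ 2 p ≤ (d : ℝ) ^ 2 * n ^ d * n ^ (2 * k) * (d * n * p) ^ (k * N) := by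
  classical
  let E (q : ((Fin d × Fin d) × (Fin d → Fin n)) × Finset (Fin n × Fin n)) :
      Set (Set (Fin d → Fin n)) :=
    {ω | ∀ z ∈ q.2, IsRich ω (N + 2 * k) (cell q.1.1.1 q.1.1.2 q.1.2 z.1 z.2)}
  let I : Finset (((Fin d × Fin d) × (Fin d → Fin n)) × Finset (Fin n × Fin n)) :=
    (univ ×ˢ powersetCard k univ).filter fun q => q.1.1.1 ≠ q.1.1.2 ∧ IsGridMatching q.2
  have subset : eventuallyOpen n d θ 2 ⊆ ⋃ q ∈ I, E q := by
    intro ω hω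
    have matching : ¬ NoRichMatching ω (N + 2 * k) k := fun h =>
      h.notMem_eventuallyOpen (by linarith) hn hω
    simp only [NoRichMatching, not_forall, not_lt] at matching
    obtain ⟨c₀, c₁, hc, w, M, hM, rich, hk⟩ := matching
    obtain ⟨M', hM', rfl⟩ := exists_subset_card_eq hk
    refine Set.mem_biUnion (x := (((c₀, c₁), w), M')) ?_ fun z hz => rich z (hM' hz)
    simpa [I, hc] using hM.mono hM'
  have card_I : (#I : ℝ) ≤ (d : ℝ) ^ 2 * n ^ d * n ^ (2 * k) := by
    have : #I ≤ d * d * n ^ d * (n * n).choose k := (card_filter_le _ _).trans_eq (by simp)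
    grw [Nat.choose_le_pow] at this
    refine (Nat.cast_le.2 this).trans_eq ?_
    push_cast
    ring
  calc openProb n d θ 2 p ≤ ∑ q ∈ I, setBer(Set.univ, p).real (E q) :=
        (measureReal_mono subset (measure_ne_top _ _)).trans (measureReal_biUnion_finset_le _ _)
    _ ≤ #I • (d * n * p : ℝ) ^ (k * N) := by
        refine sum_le_card_nsmul _ _ _ fun q hq => ?_
        simp only [I, mem_filter, mem_product, mem_univ, true_and, mem_powersetCard_univ] at hq
        obtain ⟨rfl, hc, hM⟩ := hq
        exact setBernoulli_real_rich_le p hc q.1.2 hM le_rfl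
    _ ≤ _ := by
        have := p.2.1
        grw [nsmul_eq_mul, card_I]

theorem eventually_openProb_lt (hθ : N + (d ^ 2 + 2) * k ≤ θ) (ha : (d : ℝ) + 2 * k < a * (k * N))
    (hε : 0 < ε) :
    ∀ᶠ n : ℕ in atTop, ∀ p : unitInterval, p ≤ (n : ℝ) ^ (-1 - a) → openProb n d θ 2 p < ε := by
  set K := (d : ℝ) ^ 2 * (d : ℝ) ^ (k * N)
  have decay : Tendsto (fun n : ℕ => K * (n : ℝ) ^ (-(a * (k * N) - (d + 2 * k)))) atTop (𝓝 0) := by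
    rw [← mul_zero K]
    exact ((tendsto_rpow_neg_atTop (sub_pos.2 ha)).comp tendsto_natCast_atTop_atTop).const_mul K
  filter_upwards [decay.eventually_lt_const hε, eventually_gt_atTop θ] with n small hn p hp
  have hn₀ : (0 : ℝ) < n := by exact_mod_cast (Nat.zero_le θ).trans_lt hn
  have hp₀ := p.2.1
  have mean : n * (p : ℝ) ≤ (n : ℝ) ^ (-a) := by
    calc n * (p : ℝ) ≤ (n : ℝ) ^ (1 : ℝ) * (n : ℝ) ^ (-1 - a) := by rw [Real.rpow_one]; gcongr
      _ = (n : ℝ) ^ (-a) := by rw [← Real.rpow_add hn₀]; ring_nf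
  calc openProb n d θ 2 p ≤ (d : ℝ) ^ 2 * n ^ d * n ^ (2 * k) * (d * n * p) ^ (k * N) :=
        openProb_le p hθ hn
    _ = K * (n ^ d * n ^ (2 * k) * (n * (p : ℝ)) ^ (k * N)) := by
        rw [mul_assoc (d : ℝ), mul_pow]
        ring
    _ ≤ K * (n ^ d * n ^ (2 * k) * ((n : ℝ) ^ (-a)) ^ (k * N)) := by gcongr
    _ = K * (n : ℝ) ^ (-(a * (k * N) - (d + 2 * k))) := by
        rw [← Real.rpow_mul_natCast hn₀.le, ← pow_add, ← Real.rpow_natCast, ← Real.rpow_add hn₀]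
        push_cast
        ring_nf
    _ < ε := small

end Subcritical

section MatchingSize
variable {C D : ℝ} {m θ k : ℕ}

/-- As `k / √θ → r`, the right-hand side tends to `C r - 2 m r ^ 2`, which is largest for
`r = C / (4 m)`. -/
theorem excessExponent_mul_sub_eq (hθ : 0 < θ) :
    excessExponent C θ * (k * (θ - m * k)) - 2 * k =
      C * (k / √θ) - 2 * m * (k / √θ) ^ 2 - C * m * (k / √θ) ^ 2 * (√θ)⁻¹ := by
  have : 0 < √(θ : ℝ) := Real.sqrt_pos.2 (by exact_mod_cast hθ)
  rw [excessExponent_eq]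
  nth_rewrite 3 [← Real.sq_sqrt θ.cast_nonneg]
  field_simp
  ring

theorem eventually_exists_matching_size (hm : 0 < m) (hC₀ : 0 < C) (hC : 8 * m * D < C ^ 2) :
    ∀ᶠ θ : ℕ in atTop, ∃ k N : ℕ,
      N + m * k ≤ θ ∧ D + 2 * k < excessExponent C θ * (k * N) := by
  have : (0 : ℝ) < m := by exact_mod_cast hm
  set r := C / (4 * m) with hr
  have limit_ratio : Tendsto (fun θ : ℕ => (⌊r * √θ⌋₊ : ℝ) / √θ) atTop (𝓝 r) :=
    (tendsto_nat_floor_mul_div_atTop (by positivity)).comp tendsto_sqrt_natCast_atTop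
  have limit : Tendsto (fun θ : ℕ => C * (⌊r * √θ⌋₊ / √θ) - 2 * m * (⌊r * √θ⌋₊ / √θ) ^ 2 -
      C * m * (⌊r * √θ⌋₊ / √θ) ^ 2 * (√θ)⁻¹) atTop (𝓝 (C ^ 2 / (8 * m))) := by
    have continuous : Continuous fun z : ℝ × ℝ =>
        C * z.1 - 2 * m * z.1 ^ 2 - C * m * z.1 ^ 2 * z.2 := by fun_prop
    exact (continuous.tendsto' (r, 0) (C ^ 2 / (8 * m)) (by rw [hr]; field_simp; ring)).comp
      (limit_ratio.prodMk_nhds tendsto_sqrt_natCast_atTop.inv_tendsto_atTop)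
  have large : D < C ^ 2 / (8 * m) := (lt_div_iff₀' (by positivity)).2 hC
  filter_upwards [limit.eventually_const_lt large, eventually_gt_atTop 0,
    tendsto_sqrt_natCast_atTop.eventually_ge_atTop (m * r)] with θ hlarge hθ hsqrt
  set k := ⌊r * √θ⌋₊
  have fits : m * k ≤ θ := by
    have : (m * k : ℝ) ≤ θ :=
      calc (m * k : ℝ) ≤ m * (r * √θ) := by gcongr; exact Nat.floor_le (by positivity)
        _ ≤ √θ * √θ := by rw [← mul_assoc]; gcongr
        _ = θ := Real.mul_self_sqrt θ.cast_nonneg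
    exact_mod_cast this
  refine ⟨k, θ - m * k, Nat.sub_add_cancel fits |>.le, ?_⟩
  rw [← excessExponent_mul_sub_eq hθ] at hlarge
  push_cast [fits]
  linarith

end MatchingSize

end BootstrapPercolation

open BootstrapPercolation in
theorem theorem2p4_general {d : ℕ} {c C : ℝ} (hc₀ : 0 ≤ c) (hc : c < √(8 * ((d : ℝ) - 2)))
    (hC : √(8 * d * ((d : ℝ) ^ 2 + 2)) < C) :
    ∀ᶠ θ : ℕ in atTop, ∀ᶠ n : ℕ in atTop,
      (∃! p : unitInterval, IsCriticalProb n d θ 2 p) ∧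
      ∀ p : unitInterval, IsCriticalProb n d θ 2 p →
        (n : ℝ) ^ (-1 - 2 / (θ : ℝ) - C / (θ : ℝ) ^ (3 / 2 : ℝ)) ≤ p ∧
        p ≤ (n : ℝ) ^ (-1 - 2 / (θ : ℝ) - c / (θ : ℝ) ^ (3 / 2 : ℝ)) := by
  rw [Real.lt_sqrt hc₀] at hc
  have hd : 2 ≤ d := by
    have : (2 : ℝ) < d := by linarith [sq_nonneg c]
    exact_mod_cast this.le
  have hC₀ : 0 < C := (Real.sqrt_nonneg _).trans_lt hC
  rw [Real.sqrt_lt' hC₀] at hC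
  have matching_size := eventually_exists_matching_size (m := d ^ 2 + 2) (D := d) (by positivity)
    hC₀ (by push_cast; linarith)
  have nucleus_size := eventually_nucleationExponent_lt (e := d - 2) hc₀ (by linarith)
  filter_upwards [matching_size, nucleus_size, eventually_gt_atTop 0] with θ ⟨k, N, hN, hk⟩ hS hθ
  have subcritical := eventually_openProb_lt hN hk one_half_pos
  have supercritical := eventually_lt_openProb (θ := θ) hd (by omega) (by omega)
    (by rw [excessExponent]; positivity) hS one_half_pos
  filter_upwards [subcritical, supercritical, eventually_gt_atTop 0] with n sub super hn
  refine ⟨existsUnique_isCriticalProb hn hθ hd, fun p hp => ?_⟩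
  have exponent (c : ℝ) : -1 - 2 / (θ : ℝ) - c / (θ : ℝ) ^ (3 / 2 : ℝ) = -1 - excessExponent c θ :=
    sub_sub _ _ _
  simp only [exponent]
  constructor
  · by_contra! hlt
    exact (sub p hlt.le).ne hp
  · by_contra! hlt
    have := super p hlt.le
    rw [hp] at this
    norm_num at this

theorem theorem2p4 (d : ℕ) (hd : 3 ≤ d) :
    ∃ θ₀ : ℕ, ∀ θ : ℕ, θ₀ ≤ θ → ∃ n₀ : ℕ, ∀ n : ℕ, n₀ ≤ n →
      (∃! p : unitInterval, BootstrapPercolation.IsCriticalProb n d θ 2 p) ∧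
      ∀ p : unitInterval, BootstrapPercolation.IsCriticalProb n d θ 2 p →
        (n : ℝ) ^ (-1 - 2 / (θ : ℝ) - (4 * (d : ℝ) ^ 2 + 3) / (θ : ℝ) ^ (3 / 2 : ℝ)) ≤ (p : ℝ) ∧
        (p : ℝ) ≤
          (n : ℝ) ^ (-1 - 2 / (θ : ℝ) - √(8 * ((d : ℝ) - 2.1)) / (θ : ℝ) ^ (3 / 2 : ℝ)) := by
  have three_le : (3 : ℝ) ≤ d := by exact_mod_cast hd
  have lower : √(8 * ((d : ℝ) - 2.1)) < √(8 * ((d : ℝ) - 2)) :=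
    Real.sqrt_lt_sqrt (by linarith) (by linarith)
  have upper : √(8 * d * ((d : ℝ) ^ 2 + 2)) < 4 * (d : ℝ) ^ 2 + 3 :=
    (Real.sqrt_lt' (by positivity)).2 (by nlinarith [sq_nonneg ((d : ℝ) ^ 2 - d)])
  simpa only [eventually_atTop, ge_iff_le] using
    theorem2p4_general (Real.sqrt_nonneg _) lower upper
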